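/- Let $n\ge 1$ and let $\rho$ be an $n$-qubit state, i.e. a positive semidefinite operator of trace one on $(\mathbb C^2)^{\otimes n}$, written as a $2^n\times 2^n$ matrix in the computational basis. Let $\epsilon=\begin{pmatrix}0&1\\-1&0\end{pmatrix}$, $\epsilon_n=\epsilon^{\otimes n}$, and let $I_\rho=\operatorname{Tr}(\rho^{T}\epsilon_n\rho\,\epsilon_n)$ be the Lorentz invariant of $\rho$. If $I_\rho=0$, then $\operatorname{rank}\rho\le 2^{n-1}$. In particular, let $\rho$ be a three-qubit PPT entangled state, i.e. a three-qubit state all of whose partial transposes (with respect to every subset of the three qubits) are positive semidefinite and which is not a convex combination of pure product states $|x_1\otimes x_2\otimes x_3\rangle\langle x_1\otimes x_2\otimes x_3|$ with unit vectors $x_i\in\mathbb C^2$. If $I_\rho=0$, then $\operatorname{rank}\rho=4$. -/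

import Mathlib

open scoped Matrix ComplexOrder

/-- Labels of the computational basis of `(ℂ²)^{⊗ n}`. -/
abbrev QubitIdx (n : ℕ) : Type := Fin n → Fin 2

/-- Operators on `(ℂ²)^{⊗ n}`, as matrices in the computational basis. -/
abbrev QubitMat (n : ℕ) : Type := Matrix (QubitIdx n) (QubitIdx n) ℂ

/-- `ρ` is an `n`-qubit state (density matrix): positive semidefinite of trace one. -/
def IsQubitState {n : ℕ} (ρ : QubitMat n) : Prop :=
  ρ.PosSemidef ∧ ρ.trace = 1

/-- The two-dimensional Levi-Civita symbol. -/
def leviCivita : Matrix (Fin 2) (Fin 2) ℂ := !![0, 1; -1, 0]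

/-- `ε_n = ε^{⊗ n}`: entries of a tensor product are products of the entries of the factors. -/
def leviCivitaTensor (n : ℕ) : QubitMat n :=
  Matrix.of fun a b => ∏ i, leviCivita (a i) (b i)

/-- The Lorentz invariant `I_ρ = Tr (ρᵀ ε_n ρ ε_n)`. -/
def lorentzInvariant {n : ℕ} (ρ : QubitMat n) : ℂ :=
  (ρᵀ * leviCivitaTensor n * ρ * leviCivitaTensor n).trace

/-- Partial transpose of `ρ` with respect to the set `S` of qubits. -/
def partialTranspose {n : ℕ} (S : Finset (Fin n)) (ρ : QubitMat n) : QubitMat n :=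
  Matrix.of fun a b =>
    ρ (fun i => if i ∈ S then b i else a i) (fun i => if i ∈ S then a i else b i)

/-- Positive partial transpose: every partial transpose of `ρ` is positive semidefinite. -/
def IsPPT {n : ℕ} (ρ : QubitMat n) : Prop :=
  ∀ S : Finset (Fin n), (partialTranspose S ρ).PosSemidef

/-- The product vector `x₁ ⊗ ⋯ ⊗ xₙ`, in the computational basis. -/
def productVector {n : ℕ} (x : Fin n → EuclideanSpace ℂ (Fin 2)) : QubitIdx n → ℂ :=
  fun a => ∏ i, x i (a i)

/-- The pure product states `|z⟩⟨z|`, with `z = x₁ ⊗ ⋯ ⊗ xₙ` and unit vectors `xᵢ`. -/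
def pureProductStates (n : ℕ) : Set (QubitMat n) :=
  {σ | ∃ x : Fin n → EuclideanSpace ℂ (Fin 2), (∀ i, ‖x i‖ = 1) ∧
    σ = Matrix.vecMulVec (productVector x) (star (productVector x))}

/-- (Fully) separable: a convex combination of pure product states. -/
def IsSeparableState {n : ℕ} (ρ : QubitMat n) : Prop :=
  ρ ∈ convexHull ℝ (pureProductStates n)

/-- A PPT entangled state: a state which is PPT and not separable. -/
def IsPPTEntangledState {n : ℕ} (ρ : QubitMat n) : Prop :=
  IsQubitState ρ ∧ IsPPT ρ ∧ ¬ IsSeparableState ρ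

/-! Put `E = leviCivitaTensor n`. It is real orthogonal with `Eᵀ = ±E`, so up to sign the invariant
is the trace of the product of the positive semidefinite matrices `ρᵀ` and `E * ρ * Eᵀ`. If the
trace vanishes, so does the product, hence `ρᵀ * E * ρ = 0`; the ranks of the factors `ρᵀ * E` and
`ρ`, both equal to `ρ.rank`, then add up to at most `2 ^ n`.

For three qubits this gives rank at most 4, and it remains to show that a PPT state of rank at most
3 is separable (`isSepFamily₃_of_finrank_le`). Write `ρ` as the Gram matrix of vectors `v a b c` in
a space of dimension `ρ.rank`; linear relations among them are kernel vectors of `ρ`. Invertible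
local maps preserve both PPT and separability. Three trilinear equations have a common zero on a
product of three projective lines (`exists_trilinear_zero`), so the kernel contains a product
vector, which a local map moves to `v 1 1 1 = 0`. Partial transposition keeps this diagonal entry
zero, and positivity then kills its whole row: this yields orthogonality among the `v a b c`. Either
the three neighbours of `v 1 1 1` are nonzero, form an orthogonal basis and give three product
terms, or one vanishes and, after a further local map, a product term splits off orthogonally from a
two-qubit PPT family of rank at most 3.

Such a two-qubit family is separable (`isSepFamily₂_of_finrank_le`): a kernel vector is a `2 × 2`
matrix. If singular, it is a product vector and orthogonality suffices; if invertible, a local map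
makes the family symmetric, and a rotation argument on real combinations of Hermitian matrices
applies. -/

/-! ### The Levi-Civita tensor and the rank bound. -/

theorem leviCivitaTensor_transpose_mul (n : ℕ) :
    (leviCivitaTensor n)ᵀ * leviCivitaTensor n = 1 := by
  ext a b
  simp only [Matrix.mul_apply, Matrix.transpose_apply, leviCivitaTensor, Matrix.of_apply,
    ← Finset.prod_mul_distrib]
  have key := (Finset.prod_univ_sum (fun _ : Fin n => (Finset.univ : Finset (Fin 2)))
    (fun i c => leviCivita c (a i) * leviCivita c (b i)))
  rw [Fintype.piFinset_univ] at key
  rw [← key]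
  have h2 : ∀ s t : Fin 2, ∑ c, leviCivita c s * leviCivita c t = if s = t then 1 else 0 := by
    intro s t
    fin_cases s <;> fin_cases t <;> simp [leviCivita]
  simp only [h2]
  rw [Matrix.one_apply]
  split_ifs with h
  · simp [h]
  · obtain ⟨i, hi⟩ := Function.ne_iff.mp h
    exact Finset.prod_eq_zero (Finset.mem_univ i) (by simp [hi])

theorem leviCivitaTensor_transpose (n : ℕ) :
    (leviCivitaTensor n)ᵀ = (-1 : ℂ) ^ n • leviCivitaTensor n := by
  ext a b
  have h2 : ∀ s t : Fin 2, leviCivita t s = -1 * leviCivita s t := by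
    intro s t
    fin_cases s <;> fin_cases t <;> simp [leviCivita]
  simp only [Matrix.transpose_apply, leviCivitaTensor, Matrix.of_apply, Matrix.smul_apply]
  rw [Finset.prod_congr rfl fun i _ => h2 (a i) (b i), Finset.prod_mul_distrib]
  simp

theorem leviCivitaTensor_conjTranspose (n : ℕ) :
    (leviCivitaTensor n)ᴴ = (leviCivitaTensor n)ᵀ := by
  ext a b
  have h2 : ∀ s t : Fin 2, star (leviCivita s t) = leviCivita s t := by
    intro s t
    fin_cases s <;> fin_cases t <;> simp [leviCivita]
  simp only [Matrix.conjTranspose_apply, Matrix.transpose_apply, leviCivitaTensor,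
    Matrix.of_apply, star_prod, h2]

theorem Matrix.PosSemidef.exists_eq_conjTranspose_mul_self {m : Type*} [Fintype m] [DecidableEq m]
    {A : Matrix m m ℂ} (hA : A.PosSemidef) : ∃ B : Matrix m m ℂ, A = Bᴴ * B := by
  open scoped MatrixOrder in
  obtain ⟨B, hB⟩ := CStarAlgebra.nonneg_iff_eq_star_mul_self.mp hA.nonneg
  exact ⟨B, hB⟩

/-- With `A = Xᴴ * X` and `B = Yᴴ * Y`, the trace is the squared Frobenius norm of `X * Yᴴ`. -/
theorem Matrix.PosSemidef.mul_eq_zero_of_trace_mul_eq_zero {m : Type*} [Fintype m] [DecidableEq m]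
    {A B : Matrix m m ℂ} (hA : A.PosSemidef) (hB : B.PosSemidef) (h : (A * B).trace = 0) :
    A * B = 0 := by
  obtain ⟨X, rfl⟩ := hA.exists_eq_conjTranspose_mul_self
  obtain ⟨Y, rfl⟩ := hB.exists_eq_conjTranspose_mul_self
  have h1 : ((X * Yᴴ)ᴴ * (X * Yᴴ)).trace = 0 := by
    rw [← h, Matrix.conjTranspose_mul, Matrix.conjTranspose_conjTranspose, Matrix.mul_assoc,
      Matrix.trace_mul_comm]
    simp only [Matrix.mul_assoc]
  rw [Matrix.trace_conjTranspose_mul_self_eq_zero_iff] at h1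
  calc Xᴴ * X * (Yᴴ * Y) = Xᴴ * (X * Yᴴ) * Y := by simp only [Matrix.mul_assoc]
    _ = 0 := by simp [h1]

theorem rank_le_of_lorentzInvariant_eq_zero {n : ℕ} (hn : 1 ≤ n) {ρ : QubitMat n}
    (hρ : ρ.PosSemidef) (h : lorentzInvariant ρ = 0) : ρ.rank ≤ 2 ^ (n - 1) := by
  set E := leviCivitaTensor n with hE
  have hEE : Eᵀ * E = 1 := leviCivitaTensor_transpose_mul n
  have hEU : IsUnit E.det := by
    rw [← Matrix.isUnit_iff_isUnit_det]
    exact IsUnit.of_mul_eq_one Eᵀ (mul_eq_one_comm.mp hEE)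
  have hB : (E * ρ * Eᵀ).PosSemidef := by
    rw [hE, ← leviCivitaTensor_conjTranspose]
    exact hρ.mul_mul_conjTranspose_same _
  have htr : (ρᵀ * (E * ρ * Eᵀ)).trace = 0 := by
    rw [hE, leviCivitaTensor_transpose, Matrix.mul_smul, Matrix.mul_smul, Matrix.trace_smul]
    have : (ρᵀ * (leviCivitaTensor n * ρ * leviCivitaTensor n)).trace = 0 := by
      rw [← h, lorentzInvariant]
      simp only [Matrix.mul_assoc]
    rw [this, smul_zero]
  have h0 := hρ.transpose.mul_eq_zero_of_trace_mul_eq_zero hB htr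
  have h1 : (ρᵀ * E) * ρ = 0 := by
    calc (ρᵀ * E) * ρ = ρᵀ * (E * ρ * Eᵀ) * E := by
          simp only [Matrix.mul_assoc, hEE, Matrix.mul_one]
      _ = 0 := by rw [h0, Matrix.zero_mul]
  have h2 := Matrix.rank_add_rank_le_card_of_mul_eq_zero h1
  rw [Matrix.rank_mul_eq_left_of_isUnit_det _ _ hEU, Matrix.rank_transpose] at h2
  have h3 : Fintype.card (QubitIdx n) = 2 * 2 ^ (n - 1) := by
    rw [← pow_succ', Nat.sub_add_cancel hn]
    simp [QubitIdx]
  omega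

/-! ### Local changes of basis. -/

/-- The action of a `2 × 2` matrix on pairs of vectors. -/
def localAct {X : Type*} [AddCommGroup X] [Module ℂ X] (g : Matrix (Fin 2) (Fin 2) ℂ)
    (v : Fin 2 → X) : Fin 2 → X :=
  fun a => g a 0 • v 0 + g a 1 • v 1

theorem localAct_mul {X : Type*} [AddCommGroup X] [Module ℂ X] (g h : Matrix (Fin 2) (Fin 2) ℂ)
    (v : Fin 2 → X) : localAct g (localAct h v) = localAct (g * h) v := by
  funext a
  simp only [localAct, Matrix.mul_apply, Fin.sum_univ_two]
  module

theorem localAct_one {X : Type*} [AddCommGroup X] [Module ℂ X] (v : Fin 2 → X) :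
    localAct 1 v = v := by
  funext a
  revert a
  simp [Fin.forall_fin_two, localAct]

theorem localAct_inv {X : Type*} [AddCommGroup X] [Module ℂ X] {g : Matrix (Fin 2) (Fin 2) ℂ}
    (hg : g.det ≠ 0) (v : Fin 2 → X) : localAct g⁻¹ (localAct g v) = v := by
  rw [localAct_mul, Matrix.nonsing_inv_mul _ (isUnit_iff_ne_zero.mpr hg), localAct_one]

theorem exists_det_ne_zero_row_one {x : Fin 2 → ℂ} (hx : x ≠ 0) :
    ∃ g : Matrix (Fin 2) (Fin 2) ℂ, g.det ≠ 0 ∧ g 1 = x := by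
  by_cases h0 : x 0 = 0
  · have h1 : x 1 ≠ 0 := by
      intro h1
      apply hx
      funext i
      fin_cases i <;> simp [h0, h1]
    refine ⟨!![1, 0; x 0, x 1], by simpa [Matrix.det_fin_two] using h1, ?_⟩
    funext i
    fin_cases i <;> simp
  · refine ⟨!![0, 1; x 0, x 1], by simpa [Matrix.det_fin_two] using h0, ?_⟩
    funext i
    fin_cases i <;> simp

/-! ### Real Hermitian coordinates and rotation to singular matrices. -/

section QuadraticForm

/-- The determinant of the Hermitian matrix with real coordinates `h`. -/
def hermDet (h : Fin 4 → ℝ) : ℝ := h 0 * h 3 - h 1 ^ 2 - h 2 ^ 2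

/-- Rotating the pair `(g, h)` by an angle preserves the sum of the two rank-one matrices. From
angle 0 to π/2 the determinant of the first vector moves from `hermDet g` to `hermDet h`, which do
not have the same strict sign, so it vanishes in between. -/
theorem exists_rotation_hermDet_eq_zero {g h : Fin 4 → ℝ} (hgh : hermDet g * hermDet h ≤ 0) :
    ∃ g' h' : Fin 4 → ℝ, hermDet g' = 0 ∧
      ∀ i j, g' i * g' j + h' i * h' j = g i * g j + h i * h j := by
  let f : ℝ → ℝ := fun θ => hermDet (fun i => Real.cos θ * g i + Real.sin θ * h i)
  have hf : Continuous f := by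
    unfold f hermDet
    fun_prop
  have hf0 : f 0 = hermDet g := by simp [f]
  have hf1 : f (Real.pi / 2) = hermDet h := by simp [f]
  have hθ : ∃ θ, f θ = 0 := by
    have hpre := isPreconnected_univ (α := ℝ)
    rcases le_total (hermDet g) 0 with hg | hg
    · rcases eq_or_lt_of_le hg with hg | hg
      · exact ⟨0, hf0.trans hg⟩
      · have hh : 0 ≤ hermDet h := by nlinarith
        obtain ⟨θ, -, hθ⟩ := hpre.intermediate_value (Set.mem_univ (0 : ℝ))
          (Set.mem_univ (Real.pi / 2)) hf.continuousOn
          (show (0 : ℝ) ∈ Set.Icc (f 0) (f (Real.pi / 2)) from ⟨by linarith, by linarith⟩)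
        exact ⟨θ, hθ⟩
    · rcases eq_or_lt_of_le hg with hg | hg
      · exact ⟨0, hf0.trans hg.symm⟩
      · have hh : hermDet h ≤ 0 := by nlinarith
        obtain ⟨θ, -, hθ⟩ := hpre.intermediate_value (Set.mem_univ (Real.pi / 2))
          (Set.mem_univ (0 : ℝ)) hf.continuousOn
          (show (0 : ℝ) ∈ Set.Icc (f (Real.pi / 2)) (f 0) from ⟨by linarith, by linarith⟩)
        exact ⟨θ, hθ⟩
  obtain ⟨θ, hθ⟩ := hθ
  refine ⟨fun i => Real.cos θ * g i + Real.sin θ * h i,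
    fun i => Real.cos θ * h i - Real.sin θ * g i, hθ, fun i j => ?_⟩
  linear_combination (g i * g j + h i * h j) * Real.sin_sq_add_cos_sq θ

theorem exists_mem_mul_nonpos_of_sum_eq_zero {α : Type*} (q : α → ℝ) {a : α} {l : List α}
    (ha : q a ≠ 0) (h : q a + (l.map q).sum = 0) : ∃ b ∈ l, q a * q b ≤ 0 := by
  by_contra! hc
  have h2 : 0 ≤ q a * (l.map q).sum := by
    rw [← List.sum_map_mul_left]
    apply List.sum_nonneg
    simp only [List.mem_map]
    rintro _ ⟨b, hb, rfl⟩
    exact (hc b hb).le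
  have h3 : 0 < q a * q a := mul_self_pos.mpr ha
  have h4 : q a * q a + q a * (l.map q).sum = 0 := by rw [← mul_add, h, mul_zero]
  linarith

/-- A term of nonzero determinant has a partner of opposite sign or zero determinant, since the
total is zero. Rotating the two makes one singular; the other returns to the list, now shorter by
one. The total determinant survives because it depends only on the second moments. -/
theorem exists_list_hermDet_eq_zero (n : ℕ) : ∀ l : List (Fin 4 → ℝ), l.length = n →
    (l.map hermDet).sum = 0 → ∃ l' : List (Fin 4 → ℝ), (∀ h ∈ l', hermDet h = 0) ∧
      ∀ i j, (l'.map fun h => h i * h j).sum = (l.map fun h => h i * h j).sum := by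
  induction n with
  | zero =>
    intro l hl _
    obtain rfl := List.length_eq_zero_iff.mp hl
    exact ⟨[], by simp, by simp⟩
  | succ n ih =>
    intro l hl hs
    obtain ⟨g, t, rfl⟩ := List.exists_cons_of_length_eq_add_one hl
    simp only [List.length_cons, Nat.add_right_cancel_iff] at hl
    simp only [List.map_cons, List.sum_cons] at hs
    by_cases hg : hermDet g = 0
    · obtain ⟨l', hl', hsum⟩ := ih t hl (by simpa [hg] using hs)
      exact ⟨g :: l', by simpa [hg] using hl', by simp [hsum]⟩
    · obtain ⟨h, hh, hgh⟩ := exists_mem_mul_nonpos_of_sum_eq_zero hermDet hg hs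
      obtain ⟨g', h', hg', hr⟩ := exists_rotation_hermDet_eq_zero hgh
      classical
      have hp := List.perm_cons_erase hh
      have hq : hermDet g' + hermDet h' = hermDet g + hermDet h := by
        unfold hermDet
        linear_combination hr 0 3 - hr 1 1 - hr 2 2
      rw [(hp.map hermDet).sum_eq] at hs
      simp only [List.map_cons, List.sum_cons] at hs
      obtain ⟨l', hl', hsum⟩ := ih (h' :: t.erase h)
        (by rw [← hl, hp.length_eq, List.length_cons, List.length_cons])
        (by simp only [List.map_cons, List.sum_cons]; linarith)
      refine ⟨g' :: l', by simpa [hg'] using hl', fun i j => ?_⟩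
      simp only [List.map_cons, List.sum_cons]
      rw [hsum, (hp.map fun h => h i * h j).sum_eq]
      simp only [List.map_cons, List.sum_cons]
      linarith [hr i j]

/-- Coordinates of `2 × 2` matrices with respect to a real basis of the Hermitian ones. -/
def hermCoeff : Fin 2 → Fin 2 → Fin 4 → ℂ :=
  ![![![1, 0, 0, 0], ![0, 1, Complex.I, 0]], ![![0, 1, -Complex.I, 0], ![0, 0, 0, 1]]]

theorem exists_vector_of_hermDet_eq_zero_of_pos {h : Fin 4 → ℝ} (hh : hermDet h = 0)
    (h0 : 0 ≤ h 0) (h3 : 0 ≤ h 3) :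
    ∃ x : Fin 2 → ℂ, ∀ a b, ∑ i, hermCoeff a b i * h i = star (x a) * x b := by
  unfold hermDet at hh
  rcases eq_or_lt_of_le h0 with h0 | h0
  · have h1 : h 1 = 0 := by nlinarith [sq_nonneg (h 1), sq_nonneg (h 2)]
    have h2 : h 2 = 0 := by nlinarith [sq_nonneg (h 1), sq_nonneg (h 2)]
    refine ⟨![0, (√(h 3) : ℝ)], fun a b => ?_⟩
    fin_cases a <;> fin_cases b <;>
      simp [hermCoeff, Fin.sum_univ_four, h1, h2, ← h0, ← Complex.ofReal_mul,
        Real.mul_self_sqrt h3]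
  · have hs : (√(h 0) : ℂ) ≠ 0 := by
      exact_mod_cast (Real.sqrt_pos.mpr h0).ne'
    have hs2 : (√(h 0) : ℂ) * √(h 0) = h 0 := by
      exact_mod_cast Real.mul_self_sqrt h0.le
    have hz : (h 0 : ℂ) * h 3 = h 1 ^ 2 + h 2 ^ 2 := by
      exact_mod_cast (by linarith : h 0 * h 3 = h 1 ^ 2 + h 2 ^ 2)
    have hI := Complex.I_mul_I
    -- The first row of the matrix divided by the square root of its corner entry.
    refine ⟨![(√(h 0) : ℝ), (h 1 + Complex.I * h 2) / (√(h 0) : ℝ)], fun a b => ?_⟩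
    fin_cases a <;> fin_cases b <;>
      simp [hermCoeff, Fin.sum_univ_four]
    · rw [hs2]
    · field_simp
    · field_simp
    · field_simp
      rw [pow_two, hs2]
      linear_combination hz + h 2 ^ 2 * hI

/-- A singular Hermitian matrix is plus or minus a rank-one projector up to scale, and the sign
cancels in the product. The right-hand side is grouped so that exchanging `a` and `a'` makes it the
Gram matrix of a product family. -/
theorem exists_vector_of_hermDet_eq_zero {h : Fin 4 → ℝ} (hh : hermDet h = 0) :
    ∃ x : Fin 2 → ℂ, ∀ a b a' b', star (∑ i, hermCoeff a b i * h i) *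
      (∑ i, hermCoeff a' b' i * h i) = star (x a' * x b) * (x a * x b') := by
  have h03 : 0 ≤ h 0 * h 3 := by
    unfold hermDet at hh
    nlinarith [sq_nonneg (h 1), sq_nonneg (h 2)]
  have hcase : (0 ≤ h 0 ∧ 0 ≤ h 3) ∨ (h 0 ≤ 0 ∧ h 3 ≤ 0) := mul_nonneg_iff.mp h03
  rcases hcase with ⟨h0, h3⟩ | ⟨h0, h3⟩
  · obtain ⟨x, hx⟩ := exists_vector_of_hermDet_eq_zero_of_pos hh h0 h3
    refine ⟨x, fun a b a' b' => ?_⟩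
    rw [hx, hx]
    simp only [star_mul', star_star]
    ring
  · obtain ⟨x, hx⟩ := exists_vector_of_hermDet_eq_zero_of_pos (h := -h)
      (by simpa [hermDet] using hh) (by simpa using h0) (by simpa using h3)
    refine ⟨x, fun a b a' b' => ?_⟩
    have hn : ∀ a b, ∑ i, hermCoeff a b i * h i = -(star (x a) * x b) := by
      intro a b
      rw [← hx]
      simp
    rw [hn, hn]
    simp only [star_mul', star_star, star_neg]
    ring

end QuadraticForm

/-! ### Two-qubit families: PPT, separability and the symmetric case. -/

section TwoQubit

variable {E : Type*} [NormedAddCommGroup E] [InnerProductSpace ℂ E]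

/-- The partial transpose of the Gram matrix of `u` is a Gram matrix. -/
def IsPPTFamily₂ (u : Fin 2 → Fin 2 → E) : Prop :=
  ∃ (κ : Type) (_ : Fintype κ) (u' : Fin 2 → Fin 2 → EuclideanSpace ℂ κ),
    ∀ a b a' b', inner ℂ (u' a b) (u' a' b') = inner ℂ (u a' b) (u a b')

/-- The Gram matrix of `u` is a sum of Gram matrices of product families. -/
def IsSepFamily₂ (u : Fin 2 → Fin 2 → E) : Prop :=
  ∃ (ι : Type) (_ : Fintype ι) (x y : ι → Fin 2 → ℂ),
    ∀ a b a' b', inner ℂ (u a b) (u a' b') = ∑ i, star (x i a * y i b) * (x i a' * y i b')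

theorem inner_conj_euclidean {κ : Type*} [Fintype κ] (x y : EuclideanSpace ℂ κ) :
    inner ℂ (WithLp.toLp 2 fun i => star (x i) : EuclideanSpace ℂ κ)
      (WithLp.toLp 2 fun i => star (y i)) = inner ℂ y x := by
  simp [PiLp.inner_apply, mul_comm]

theorem IsPPTFamily₂.swap {u : Fin 2 → Fin 2 → E} (h : IsPPTFamily₂ u) :
    IsPPTFamily₂ (fun a b => u b a) := by
  obtain ⟨κ, _, u', h⟩ := h
  refine ⟨κ, inferInstance, fun a b => WithLp.toLp 2 fun i => star (u' b a i),
    fun a b a' b' => ?_⟩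
  rw [inner_conj_euclidean, h]

theorem IsPPTFamily₂.localAct {u : Fin 2 → Fin 2 → E} (h : IsPPTFamily₂ u)
    (g : Matrix (Fin 2) (Fin 2) ℂ) : IsPPTFamily₂ (localAct g u) := by
  obtain ⟨κ, _, u', h⟩ := h
  refine ⟨κ, inferInstance, _root_.localAct (g.map star) u', fun a b a' b' => ?_⟩
  simp only [_root_.localAct, Pi.add_apply, Pi.smul_apply, inner_add_left, inner_add_right,
    inner_smul_left, inner_smul_right, h, Matrix.map_apply, starRingEnd_apply, star_star]
  ring

theorem IsSepFamily₂.swap {u : Fin 2 → Fin 2 → E} (h : IsSepFamily₂ u) :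
    IsSepFamily₂ (fun a b => u b a) := by
  obtain ⟨ι, _, x, y, h⟩ := h
  refine ⟨ι, inferInstance, y, x, fun a b a' b' => ?_⟩
  rw [h]
  simp only [mul_comm]

theorem IsSepFamily₂.localAct {u : Fin 2 → Fin 2 → E} (h : IsSepFamily₂ u)
    (g : Matrix (Fin 2) (Fin 2) ℂ) : IsSepFamily₂ (localAct g u) := by
  obtain ⟨ι, _, x, y, h⟩ := h
  refine ⟨ι, inferInstance, fun i => _root_.localAct g (x i), y, fun a b a' b' => ?_⟩
  simp only [_root_.localAct, Pi.add_apply, Pi.smul_apply, inner_add_left, inner_add_right,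
    inner_smul_left, inner_smul_right, h, Finset.mul_sum, ← Finset.sum_add_distrib,
    starRingEnd_apply]
  refine Finset.sum_congr rfl fun i _ => ?_
  simp only [smul_eq_mul, star_mul', star_add]
  ring

theorem IsSepFamily₂.of_localAct {u : Fin 2 → Fin 2 → E} {g : Matrix (Fin 2) (Fin 2) ℂ}
    (hg : g.det ≠ 0) (h : IsSepFamily₂ (_root_.localAct g u)) : IsSepFamily₂ u := by
  simpa only [localAct_inv hg] using h.localAct g⁻¹

theorem IsSepFamily₂.of_localAct_swap {u : Fin 2 → Fin 2 → E} {g : Matrix (Fin 2) (Fin 2) ℂ}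
    (hg : g.det ≠ 0) (h : IsSepFamily₂ (_root_.localAct g fun a b => u b a)) :
    IsSepFamily₂ u :=
  (h.of_localAct hg).swap

/-- `u' 1 1` has the same norm as `u 1 1`, hence vanishes, and so do its inner products. -/
theorem IsPPTFamily₂.inner_eq_zero {u : Fin 2 → Fin 2 → E} (h : IsPPTFamily₂ u)
    (h1 : u 1 1 = 0) (b : Fin 2) : inner ℂ (u 1 b) (u 0 1) = 0 := by
  obtain ⟨κ, _, u', h⟩ := h
  have h2 : u' 1 1 = 0 := by
    rw [← inner_self_eq_zero (𝕜 := ℂ), h, h1, inner_zero_left]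
  rw [← h, h2, inner_zero_right]

theorem isSepFamily₂_of_orthogonal {n : ℕ} {u : Fin 2 → Fin 2 → E} (e : Fin n → E)
    (he : Pairwise fun i j => inner ℂ (e i) (e j) = 0) (x y : Fin n → Fin 2 → ℂ)
    (hu : ∀ a b, u a b = ∑ i, (x i a * y i b) • e i) : IsSepFamily₂ u := by
  refine ⟨Fin n, inferInstance, fun i a => ‖e i‖ * x i a, y, fun a b a' b' => ?_⟩
  rw [hu, hu, sum_inner]
  refine Finset.sum_congr rfl fun i _ => ?_
  rw [inner_sum, Finset.sum_eq_single i]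
  · rw [inner_smul_left, inner_smul_right, inner_self_eq_norm_sq_to_K]
    simp
    ring
  · intro j _ hj
    rw [inner_smul_left, inner_smul_right, he hj.symm]
    simp
  · simp

/-- Symmetry makes the partially transposed Gram matrix real in Hermitian coordinates, hence a sum
of real rank-one terms, each from a Hermitian matrix. Their determinants sum to zero, so they can be
rotated until every one is singular; each then contributes a product term. -/
theorem isSepFamily₂_of_symmetric {u : Fin 2 → Fin 2 → E} (h : IsPPTFamily₂ u)
    (hs : u 0 1 = u 1 0) : IsSepFamily₂ u := by
  obtain ⟨κ, _, u', h⟩ := h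
  let H : Fin 4 → EuclideanSpace ℂ κ :=
    ![u' 0 0, (1 / 2 : ℂ) • (u' 0 1 + u' 1 0), (-Complex.I / 2) • (u' 0 1 - u' 1 0), u' 1 1]
  have hI := Complex.I_mul_I
  have hu' : ∀ a b, u' a b = ∑ i, hermCoeff a b i • H i := by
    intro a b
    fin_cases a <;> fin_cases b <;> simp [hermCoeff, H, Fin.sum_univ_four]
    all_goals match_scalars
    all_goals first
      | linear_combination (1 / 2) * hI
      | linear_combination (-1 / 2) * hI
  -- By `hs`, conjugating the Gram matrix of `u'` amounts to exchanging the two indices of each `u'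
  -- a b`, and the coordinates `H` absorb this exchange.
  have hreal : ∀ i j, (inner ℂ (H i) (H j)).im = 0 := by
    have hpp := inner_self_im (𝕜 := ℂ) (u 0 0)
    have hqq := inner_self_im (𝕜 := ℂ) (u 1 1)
    have hss := inner_self_im (𝕜 := ℂ) (u 1 0)
    have h1 := inner_im_symm (𝕜 := ℂ) (u 0 0) (u 1 0)
    have h2 := inner_im_symm (𝕜 := ℂ) (u 0 0) (u 1 1)
    have h3 := inner_im_symm (𝕜 := ℂ) (u 1 1) (u 1 0)
    have h4 := inner_re_symm (𝕜 := ℂ) (u 0 0) (u 1 0)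
    have h5 := inner_re_symm (𝕜 := ℂ) (u 0 0) (u 1 1)
    have h6 := inner_re_symm (𝕜 := ℂ) (u 1 1) (u 1 0)
    simp only [RCLike.im_to_complex, RCLike.re_to_complex] at hpp hqq hss h1 h2 h3 h4 h5 h6
    intro i j
    fin_cases i <;> fin_cases j <;>
      simp [-inner_self_eq_norm_sq_to_K, H, h, hs] <;> linarith
  let l : List (Fin 4 → ℝ) :=
    (Finset.univ.toList.map fun k i => (H i k).re) ++
      (Finset.univ.toList.map fun k i => (H i k).im)
  have hl : ∀ i j, (l.map fun h => h i * h j).sum = (inner ℂ (H i) (H j)).re := by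
    intro i j
    simp only [l, List.map_append, List.map_map, List.sum_append, Function.comp_def,
      Finset.sum_map_toList, PiLp.inner_apply, Complex.re_sum, ← Finset.sum_add_distrib]
    refine Finset.sum_congr rfl fun k _ => ?_
    simp
    ring
  -- The total is the real part of ⟨u' 0 0, u' 1 1⟩ minus half of ‖u' 0 1‖² + ‖u' 1 0‖²; by `h` and
  -- `hs` both equal ‖u 1 0‖².
  have hdet : (l.map hermDet).sum = 0 := by
    have : (l.map hermDet).sum = (l.map fun h => h 0 * h 3).sum -
        (l.map fun h => h 1 * h 1).sum - (l.map fun h => h 2 * h 2).sum := by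
      induction l with
      | nil => simp
      | cons h t ih =>
        simp only [List.map_cons, List.sum_cons, ih, hermDet]
        ring
    rw [this, hl, hl, hl]
    simp [-inner_self_eq_norm_sq_to_K, H, h, hs]
    ring
  obtain ⟨l', hl0, hl'⟩ := exists_list_hermDet_eq_zero _ l rfl hdet
  have hx : ∀ k : Fin l'.length, ∃ x : Fin 2 → ℂ, ∀ a b a' b',
      star (∑ i, hermCoeff a b i * l'[k] i) * (∑ i, hermCoeff a' b' i * l'[k] i) =
        star (x a' * x b) * (x a * x b') :=
    fun k => exists_vector_of_hermDet_eq_zero (hl0 _ (List.getElem_mem _))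
  choose x hx using hx
  have hT : ∀ i j, inner ℂ (H i) (H j) = ∑ k : Fin l'.length, (l'[k] i : ℂ) * l'[k] j := by
    intro i j
    apply Complex.ext
    · rw [← hl, ← hl', ← Fin.sum_univ_fun_getElem]
      simp
    · rw [hreal]
      simp
  refine ⟨Fin l'.length, inferInstance, x, x, fun a b a' b' => ?_⟩
  rw [← h a' b a b', hu', hu', sum_inner]
  simp only [inner_sum, inner_smul_left, inner_smul_right, hT, ← hx]
  simp only [Fin.sum_univ_four, Finset.mul_sum, ← Finset.sum_add_distrib]
  refine Finset.sum_congr rfl fun k _ => ?_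
  simp only [star_add, star_mul', Complex.star_def, Complex.conj_ofReal]
  ring

end TwoQubit

/-! ### Two-qubit PPT families of rank at most three. -/

section

variable {E : Type*} [NormedAddCommGroup E] [InnerProductSpace ℂ E]

theorem exists_eq_zero_of_pairwise_orthogonal [FiniteDimensional ℂ E] {n : ℕ}
    (hE : Module.finrank ℂ E < n) (e : Fin n → E)
    (he : Pairwise fun i j => inner ℂ (e i) (e j) = 0) : ∃ i, e i = 0 := by
  by_contra! hne
  have hli := linearIndependent_of_ne_zero_of_inner_eq_zero hne he
  have := hli.fintype_card_le_finrank
  rw [Fintype.card_fin] at this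
  omega

theorem exists_sum_smul_eq_zero [FiniteDimensional ℂ E] (hE : Module.finrank ℂ E ≤ 3)
    (u : Fin 2 → Fin 2 → E) : ∃ m : Fin 2 → Fin 2 → ℂ, m ≠ 0 ∧ ∑ a, ∑ b, m a b • u a b = 0 := by
  have h : ¬ LinearIndependent ℂ (fun p : Fin 2 × Fin 2 => u p.1 p.2) := by
    intro hli
    have := hli.fintype_card_le_finrank
    simp at this
    omega
  rw [Fintype.not_linearIndependent_iff] at h
  obtain ⟨g, hg, ⟨i, j⟩, hij⟩ := h
  refine ⟨fun a b => g (a, b), fun h0 => hij ?_, ?_⟩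
  · exact congrFun (congrFun h0 i) j
  · rw [← hg, Fintype.sum_prod_type]

theorem exists_eq_mul_of_det_eq_zero {m : Fin 2 → Fin 2 → ℂ} (hm : m ≠ 0)
    (hdet : m 0 0 * m 1 1 = m 0 1 * m 1 0) :
    ∃ x y : Fin 2 → ℂ, x ≠ 0 ∧ y ≠ 0 ∧ ∀ a b, m a b = x a * y b := by
  obtain ⟨i, hi⟩ := Function.ne_iff.mp hm
  obtain ⟨j, hij⟩ := Function.ne_iff.mp hi
  refine ⟨fun a => m a j / m i j, m i, ?_, hi, ?_⟩
  · exact Function.ne_iff.mpr ⟨i, by simpa using hij⟩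
  · have hij' : m i j ≠ 0 := hij
    intro a b
    field_simp
    revert i j a b
    simp only [Fin.forall_fin_two]
    grind

theorem exists_inner_sub_smul_eq_zero (e x : E) : ∃ t : ℂ, inner ℂ e (x - t • e) = 0 := by
  by_cases he : e = 0
  · exact ⟨0, by simp [he]⟩
  · refine ⟨inner ℂ e x / inner ℂ e e, ?_⟩
    rw [inner_sub_right, inner_smul_right, div_mul_cancel₀ _ (inner_self_ne_zero.mpr he), sub_self]

theorem eq_zero_of_inner_eq_zero [FiniteDimensional ℂ E] (hE : Module.finrank ℂ E ≤ 3)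
    {e f g x : E} (he : e ≠ 0) (hf : f ≠ 0) (hg : g ≠ 0) (hef : inner ℂ e f = 0)
    (heg : inner ℂ e g = 0) (hfg : inner ℂ f g = 0) (hex : inner ℂ e x = 0)
    (hfx : inner ℂ f x = 0) (hgx : inner ℂ g x = 0) : x = 0 := by
  obtain ⟨i, hi⟩ := exists_eq_zero_of_pairwise_orthogonal (by omega : Module.finrank ℂ E < 4)
    ![e, f, g, x] (by
      intro i j hij
      fin_cases i <;> fin_cases j <;> first
        | exact absurd rfl hij
        | assumption
        | (exact inner_eq_zero_symm.mp (by assumption)))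
  fin_cases i
  · exact absurd hi he
  · exact absurd hi hf
  · exact absurd hi hg
  · exact hi

theorem exists_smul_of_inner_eq_zero [FiniteDimensional ℂ E] (hE : Module.finrank ℂ E ≤ 3)
    {e f g x : E} (he : e ≠ 0) (hf : f ≠ 0) (hg : g ≠ 0) (hef : inner ℂ e f = 0)
    (heg : inner ℂ e g = 0) (hfg : inner ℂ f g = 0) (hx : inner ℂ e x = 0) :
    ∃ s t : ℂ, x = s • f + t • g := by
  obtain ⟨s, hs⟩ := exists_inner_sub_smul_eq_zero f x
  obtain ⟨t, ht⟩ := exists_inner_sub_smul_eq_zero g (x - s • f)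
  have h1 : inner ℂ e (x - s • f - t • g) = 0 := by
    simp [hx, hef, heg]
  have h2 : inner ℂ f (x - s • f - t • g) = 0 := by
    rw [inner_sub_right, hs, inner_smul_right, hfg]
    simp
  refine ⟨s, t, ?_⟩
  have h4 := eq_zero_of_inner_eq_zero hE he hf hg hef heg hfg h1 h2 ht
  rw [sub_sub, sub_eq_zero] at h4
  exact h4

/-- Here `u 1 0` and `u 0 1` are orthogonal; splitting `u 0 0` along them and a remainder gives
three orthogonal product terms. -/
theorem isSepFamily₂_of_apply_eq_zero {u : Fin 2 → Fin 2 → E} (h : IsPPTFamily₂ u)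
    (h1 : u 1 1 = 0) : IsSepFamily₂ u := by
  have h10 := h.inner_eq_zero h1 0
  have h01 := inner_eq_zero_symm.mp h10
  obtain ⟨s, hs⟩ := exists_inner_sub_smul_eq_zero (u 1 0) (u 0 0)
  obtain ⟨t, ht⟩ := exists_inner_sub_smul_eq_zero (u 0 1) (u 0 0 - s • u 1 0)
  have hs' : inner ℂ (u 1 0) (u 0 0 - s • u 1 0 - t • u 0 1) = 0 := by
    rw [inner_sub_right, hs, inner_smul_right, h10]
    simp
  refine isSepFamily₂_of_orthogonal ![u 0 0 - s • u 1 0 - t • u 0 1, u 1 0, u 0 1] ?_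
    ![![1, 0], ![s, 1], ![1, 0]] ![![1, 0], ![1, 0], ![t, 1]] ?_
  · intro i j hij
    fin_cases i <;> fin_cases j <;> first
      | exact absurd rfl hij
      | assumption
      | (exact inner_eq_zero_symm.mp (by assumption))
  · intro a b
    fin_cases a <;> fin_cases b <;> simp [Fin.sum_univ_three, h1]
    module

theorem isSepFamily₂_of_finrank_le [FiniteDimensional ℂ E] (hE : Module.finrank ℂ E ≤ 3)
    {u : Fin 2 → Fin 2 → E} (h : IsPPTFamily₂ u) : IsSepFamily₂ u := by
  obtain ⟨m, hm, hmu⟩ := exists_sum_smul_eq_zero hE u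
  simp only [Fin.sum_univ_two] at hmu
  by_cases hdet : m 0 0 * m 1 1 = m 0 1 * m 1 0
  · obtain ⟨x, y, hx, hy, hxy⟩ := exists_eq_mul_of_det_eq_zero hm hdet
    obtain ⟨g, hg, rfl⟩ := exists_det_ne_zero_row_one hx
    obtain ⟨g', hg', rfl⟩ := exists_det_ne_zero_row_one hy
    refine IsSepFamily₂.of_localAct hg (IsSepFamily₂.of_localAct_swap hg' ?_)
    refine isSepFamily₂_of_apply_eq_zero ((h.localAct g).swap.localAct g') ?_
    rw [← hmu]
    simp only [hxy, localAct, Pi.add_apply, Pi.smul_apply]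
    module
  -- This matrix is `m` multiplied by a `2 × 2` antisymmetric matrix, so that the relation becomes
  -- the antisymmetric one, equality of the two mixed vectors.
  · refine IsSepFamily₂.of_localAct_swap (g := !![-m 1 0, -m 1 1; m 0 0, m 0 1]) ?_ ?_
    · rw [Matrix.det_fin_two_of]
      intro h0
      apply hdet
      linear_combination h0
    · refine isSepFamily₂_of_symmetric (h.swap.localAct _) ?_
      rw [← sub_eq_zero, ← neg_eq_zero, ← hmu]
      simp [localAct]
      module

end

/-! ### Product vectors in the kernel: three trilinear equations. -/

section ProductKernel

/-- The `3 × 3` minor of three vectors. -/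
def minor₃ {R : Type*} [CommRing R] (a b c : Fin 3 → R) : R :=
  a 0 * (b 1 * c 2 - b 2 * c 1) - a 1 * (b 0 * c 2 - b 2 * c 0) + a 2 * (b 0 * c 1 - b 1 * c 0)

/-- The signed maximal minors of four vectors in dimension three. -/
def signedMinors {R : Type*} [CommRing R] (n : Fin 2 → Fin 2 → Fin 3 → R) : Fin 2 → Fin 2 → R :=
  ![![minor₃ (n 0 1) (n 1 0) (n 1 1), -minor₃ (n 0 0) (n 1 0) (n 1 1)],
    ![minor₃ (n 0 0) (n 0 1) (n 1 1), -minor₃ (n 0 0) (n 0 1) (n 1 0)]]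

/-- The determinant of the `2 × 2` matrix of signed maximal minors. -/
def minorsDet {R : Type*} [CommRing R] (n : Fin 2 → Fin 2 → Fin 3 → R) : R :=
  signedMinors n 0 0 * signedMinors n 1 1 - signedMinors n 0 1 * signedMinors n 1 0

/-- Laplace expansion of a `4 × 4` determinant with a repeated row. -/
theorem signedMinors_sum {R : Type*} [CommRing R] (n : Fin 2 → Fin 2 → Fin 3 → R) (k : Fin 3) :
    ∑ a, ∑ b, signedMinors n a b * n a b k = 0 := by
  fin_cases k <;> simp [Fin.sum_univ_two, signedMinors, minor₃] <;> ring

theorem map_minorsDet {R S : Type*} [CommRing R] [CommRing S] (f : R →+* S)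
    (n : Fin 2 → Fin 2 → Fin 3 → R) :
    f (minorsDet n) = minorsDet fun a b k => f (n a b k) := by
  simp [minorsDet, signedMinors, minor₃]

theorem eval_minorsDet (t : ℂ) (n : Fin 2 → Fin 2 → Fin 3 → Polynomial ℂ) :
    (minorsDet n).eval t = minorsDet fun a b k => (n a b k).eval t :=
  map_minorsDet (Polynomial.evalRingHom t) n

theorem minorsDet_smul {R : Type*} [CommRing R] (t : R) (n : Fin 2 → Fin 2 → Fin 3 → R) :
    minorsDet (fun a b k => t * n a b k) = t ^ 6 * minorsDet n := by
  have h : ∀ a b c : Fin 3 → R, minor₃ (fun k => t * a k) (fun k => t * b k) (fun k => t * c k) =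
      t ^ 3 * minor₃ a b c := by
    intro a b c
    unfold minor₃
    ring
  simp [minorsDet, signedMinors, h]
  ring

/-- The expression is a binary form of degree 6 in `z`, so it has a projective zero. `P` and `Q` are
its two dehomogenisations; if `P` is a nonzero constant, the zero is at infinity. -/
theorem exists_minorsDet_eq_zero (p q : Fin 2 → Fin 2 → Fin 3 → ℂ) :
    ∃ z : Fin 2 → ℂ, z ≠ 0 ∧ minorsDet (fun a b k => z 0 * p a b k + z 1 * q a b k) = 0 := by
  obtain ⟨P, hP⟩ : ∃ P : Polynomial ℂ,
      ∀ t, P.eval t = minorsDet fun a b k => 1 * p a b k + t * q a b k :=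
    ⟨minorsDet fun a b k => Polynomial.C (p a b k) + Polynomial.X * Polynomial.C (q a b k),
      fun t => by simp only [eval_minorsDet, Polynomial.eval_add, Polynomial.eval_mul,
        Polynomial.eval_C, Polynomial.eval_X, one_mul]⟩
  obtain ⟨Q, hQ⟩ : ∃ Q : Polynomial ℂ,
      ∀ t, Q.eval t = minorsDet fun a b k => t * p a b k + 1 * q a b k :=
    ⟨minorsDet fun a b k => Polynomial.X * Polynomial.C (p a b k) + Polynomial.C (q a b k),
      fun t => by simp only [eval_minorsDet, Polynomial.eval_add, Polynomial.eval_mul,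
        Polynomial.eval_C, Polynomial.eval_X, one_mul]⟩
  -- The zero polynomial has degree `⊥`, so it falls under the second case.
  by_cases hdeg : P.degree = 0
  · obtain ⟨c, hc⟩ : ∃ c, P = Polynomial.C c := ⟨_, Polynomial.eq_C_of_degree_eq_zero hdeg⟩
    have hQc : Q = Polynomial.C c * Polynomial.X ^ 6 := by
      refine Polynomial.eq_of_infinite_eval_eq _ _
        ((Set.finite_singleton (0 : ℂ)).infinite_compl.mono ?_)
      intro t ht
      have ht : t ≠ 0 := ht
      have h1 := hP t⁻¹
      rw [hc, Polynomial.eval_C] at h1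
      simp only [Set.mem_ofPred_eq, Polynomial.eval_mul, Polynomial.eval_C, Polynomial.eval_pow,
        Polynomial.eval_X]
      rw [hQ, h1, mul_comm, ← minorsDet_smul]
      congr! 4
      field_simp
    refine ⟨![0, 1], fun h => one_ne_zero (congrFun h 1), ?_⟩
    have h0 := hQ 0
    rw [hQc] at h0
    simpa using h0.symm
  · obtain ⟨t, ht⟩ := IsAlgClosed.exists_root P hdeg
    refine ⟨![1, t], fun h => one_ne_zero (congrFun h 0), ?_⟩
    rw [Polynomial.IsRoot.def, hP] at ht
    simpa using ht

/-- For fixed `x` these are two linear equations in `y`, solvable nontrivially when their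
determinant, a binary quadratic form in `x`, vanishes. -/
theorem exists_bilinear_zero (p q : Fin 2 → Fin 2 → ℂ) : ∃ x y : Fin 2 → ℂ, x ≠ 0 ∧ y ≠ 0 ∧
    ∑ a, ∑ b, x a * y b * p a b = 0 ∧ ∑ a, ∑ b, x a * y b * q a b = 0 := by
  have key : ∃ x : Fin 2 → ℂ, x ≠ 0 ∧
      (x 0 * p 0 0 + x 1 * p 1 0) * (x 0 * q 0 1 + x 1 * q 1 1) -
      (x 0 * p 0 1 + x 1 * p 1 1) * (x 0 * q 0 0 + x 1 * q 1 0) = 0 := by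
    by_cases hA : p 1 0 * q 1 1 - p 1 1 * q 1 0 = 0
    · refine ⟨![0, 1], fun h => one_ne_zero (congrFun h 1), ?_⟩
      simpa using hA
    · obtain ⟨t, ht⟩ := exists_quadratic_eq_zero hA
        (b := p 0 0 * q 1 1 + p 1 0 * q 0 1 - p 0 1 * q 1 0 - p 1 1 * q 0 0)
        (c := p 0 0 * q 0 1 - p 0 1 * q 0 0)
        (by
          obtain ⟨s, hs⟩ := IsAlgClosed.exists_pow_nat_eq (discrim _ _ _ : ℂ) two_pos
          exact ⟨s, by rw [← sq]; exact hs.symm⟩)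
      refine ⟨![1, t], fun h => one_ne_zero (congrFun h 0), ?_⟩
      simp
      linear_combination ht
  obtain ⟨x, hx, hdet⟩ := key
  have hker := Matrix.exists_mulVec_eq_zero_iff (M := !![x 0 * p 0 0 + x 1 * p 1 0,
    x 0 * p 0 1 + x 1 * p 1 1; x 0 * q 0 0 + x 1 * q 1 0, x 0 * q 0 1 + x 1 * q 1 1])
  rw [Matrix.det_fin_two_of] at hker
  obtain ⟨y, hy, hxy⟩ := hker.mpr hdet
  refine ⟨x, y, hx, hy, ?_, ?_⟩
  · have := congrFun hxy 0
    simp [Matrix.mulVec, dotProduct, Fin.sum_univ_two] at this ⊢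
    linear_combination this
  · have := congrFun hxy 1
    simp [Matrix.mulVec, dotProduct, Fin.sum_univ_two] at this ⊢
    linear_combination this

theorem minor₃_eq_zero_of_signedMinors_eq_zero {n : Fin 2 → Fin 2 → Fin 3 → ℂ}
    (h : signedMinors n = 0) (i j k : Fin 2 × Fin 2) :
    minor₃ (n i.1 i.2) (n j.1 j.2) (n k.1 k.2) = 0 := by
  have h00 := congrFun (congrFun h 0) 0
  have h01 := congrFun (congrFun h 0) 1
  have h10 := congrFun (congrFun h 1) 0
  have h11 := congrFun (congrFun h 1) 1
  simp [signedMinors] at h00 h01 h10 h11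
  unfold minor₃ at *
  obtain ⟨a, b⟩ := i
  obtain ⟨c, d⟩ := j
  obtain ⟨e, f⟩ := k
  revert a b c d e f
  simp only [Fin.forall_fin_two]
  and_intros
  all_goals first
    | ring1
    | linear_combination h00
    | linear_combination -h00
    | linear_combination h01
    | linear_combination -h01
    | linear_combination h10
    | linear_combination -h10
    | linear_combination h11
    | linear_combination -h11

/-- The vectors span at most a plane: a nonzero cross product of two of them is a normal; if all are
parallel, the cross product of one with any independent vector serves. -/
theorem exists_dotProduct_eq_zero {ι : Type*} (c : ι → Fin 3 → ℂ)
    (h : ∀ i j k, minor₃ (c i) (c j) (c k) = 0) :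
    ∃ l : Fin 3 → ℂ, l ≠ 0 ∧ ∀ i, l 0 * c i 0 + l 1 * c i 1 + l 2 * c i 2 = 0 := by
  let X (a b : Fin 3 → ℂ) : Fin 3 → ℂ :=
    ![a 1 * b 2 - a 2 * b 1, a 2 * b 0 - a 0 * b 2, a 0 * b 1 - a 1 * b 0]
  by_cases h1 : ∃ i j, X (c i) (c j) ≠ 0
  · obtain ⟨i, j, hij⟩ := h1
    refine ⟨_, hij, fun k => ?_⟩
    rw [← h i j k]
    simp [X, minor₃]
    ring
  push Not at h1
  by_cases h2 : ∃ i, c i ≠ 0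
  · obtain ⟨i, hi⟩ := h2
    have h3 : ∃ e, X (c i) e ≠ 0 := by
      by_contra! h3
      apply hi
      have ha := h3 ![1, 0, 0]
      have hb := h3 ![0, 1, 0]
      have ha1 := congrFun ha 1
      have ha2 := congrFun ha 2
      have hb2 := congrFun hb 2
      simp [X] at ha1 ha2 hb2
      funext k
      fin_cases k <;> simp [ha1, ha2, hb2]
    obtain ⟨e, he⟩ := h3
    refine ⟨_, he, fun j => ?_⟩
    have h4 := h1 i j
    have h40 := congrFun h4 0
    have h41 := congrFun h4 1
    have h42 := congrFun h4 2
    simp [X] at h40 h41 h42 ⊢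
    linear_combination -e 0 * h40 - e 1 * h41 - e 2 * h42
  · push Not at h2
    exact ⟨1, one_ne_zero, fun i => by simp [h2 i]⟩

/-- All minors vanish, so one of the three equations follows from the other two, and
`exists_bilinear_zero` solves those. -/
theorem exists_bilinear_zero_of_signedMinors_eq_zero {n : Fin 2 → Fin 2 → Fin 3 → ℂ}
    (h : signedMinors n = 0) : ∃ x y : Fin 2 → ℂ, x ≠ 0 ∧ y ≠ 0 ∧
      ∀ k, ∑ a, ∑ b, x a * y b * n a b k = 0 := by
  obtain ⟨l, hl, hln⟩ := exists_dotProduct_eq_zero (fun p : Fin 2 × Fin 2 => n p.1 p.2)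
    (minor₃_eq_zero_of_signedMinors_eq_zero h)
  obtain ⟨k, hk⟩ := Function.ne_iff.mp hl
  have hk : l k ≠ 0 := hk
  obtain ⟨x, y, hx, hy, h1, h2⟩ :=
    exists_bilinear_zero (fun a b => n a b (k + 1)) (fun a b => n a b (k + 2))
  refine ⟨x, y, hx, hy, ?_⟩
  have hsum : ∑ a, ∑ b, x a * y b * (l k * n a b k) = 0 := by
    have : ∀ a b, l k * n a b k = -(l (k + 1) * n a b (k + 1)) - l (k + 2) * n a b (k + 2) := by
      intro a b
      have := hln (a, b)
      clear h1 h2 hk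
      fin_cases k <;> simp at this ⊢ <;> linear_combination this
    simp only [this, Fin.sum_univ_two] at h1 h2 ⊢
    linear_combination -l (k + 1) * h1 - l (k + 2) * h2
  have h0 : ∑ a, ∑ b, x a * y b * n a b k = 0 := by
    refine (mul_eq_zero.mp ?_).resolve_left hk
    rw [← hsum]
    simp only [Fin.sum_univ_two]
    ring
  clear hsum hk
  intro j
  have hj : ∀ k j : Fin 3, j = k ∨ j = k + 1 ∨ j = k + 2 := by decide
  rcases hj k j with rfl | rfl | rfl <;> assumption

/-- Choose `z` so that the matrix of signed minors is singular. If nonzero, it factors as `x a * y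
b` and solves the system by Cramer's rule. -/
theorem exists_trilinear_zero (p q : Fin 2 → Fin 2 → Fin 3 → ℂ) :
    ∃ x y z : Fin 2 → ℂ, x ≠ 0 ∧ y ≠ 0 ∧ z ≠ 0 ∧
      ∀ k, ∑ a, ∑ b, x a * y b * (z 0 * p a b k + z 1 * q a b k) = 0 := by
  obtain ⟨z, hz, hdet⟩ := exists_minorsDet_eq_zero p q
  set n : Fin 2 → Fin 2 → Fin 3 → ℂ := fun a b k => z 0 * p a b k + z 1 * q a b k
  by_cases hm : signedMinors n = 0
  · obtain ⟨x, y, hx, hy, h⟩ := exists_bilinear_zero_of_signedMinors_eq_zero hm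
    exact ⟨x, y, z, hx, hy, hz, h⟩
  · obtain ⟨x, y, hx, hy, h⟩ := exists_eq_mul_of_det_eq_zero hm (sub_eq_zero.mp hdet)
    refine ⟨x, y, z, hx, hy, hz, fun k => ?_⟩
    simp only [← h]
    exact signedMinors_sum n k

end ProductKernel

/-! ### Three-qubit families: PPT and separability. -/

section ThreeQubit

variable {E : Type*} [NormedAddCommGroup E] [InnerProductSpace ℂ E]

/-- The partial transpose, in the first index, of the Gram matrix of `v` is a Gram matrix. -/
def HasPosPartialTranspose (v : Fin 2 → Fin 2 → Fin 2 → E) : Prop :=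
  ∃ (κ : Type) (_ : Fintype κ) (v' : Fin 2 → Fin 2 → Fin 2 → EuclideanSpace ℂ κ),
    ∀ a b c a' b' c', inner ℂ (v' a b c) (v' a' b' c') = inner ℂ (v a' b c) (v a b' c')

/-- The partial transposes of the Gram matrix of `v` in each of the indices are positive. -/
def IsPPTFamily₃ (v : Fin 2 → Fin 2 → Fin 2 → E) : Prop :=
  HasPosPartialTranspose v ∧ HasPosPartialTranspose (fun a b c => v b a c) ∧
    HasPosPartialTranspose (fun a b c => v c b a)

/-- The Gram matrix of `v` is a sum of Gram matrices of product families. -/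
def IsSepFamily₃ (v : Fin 2 → Fin 2 → Fin 2 → E) : Prop :=
  ∃ (ι : Type) (_ : Fintype ι) (x y z : ι → Fin 2 → ℂ), ∀ a b c a' b' c',
    inner ℂ (v a b c) (v a' b' c') =
      ∑ i, star (x i a * y i b * z i c) * (x i a' * y i b' * z i c')

namespace HasPosPartialTranspose

variable {v : Fin 2 → Fin 2 → Fin 2 → E}

theorem swap₂₃ (h : HasPosPartialTranspose v) :
    HasPosPartialTranspose (fun a b c => v a c b) := by
  obtain ⟨κ, _, v', h⟩ := h
  exact ⟨κ, inferInstance, fun a b c => v' a c b, fun a b c a' b' c' => h a c b a' c' b'⟩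

theorem localAct (h : HasPosPartialTranspose v) (g : Matrix (Fin 2) (Fin 2) ℂ) :
    HasPosPartialTranspose (localAct g v) := by
  obtain ⟨κ, _, v', h⟩ := h
  refine ⟨κ, inferInstance, _root_.localAct (g.map star) v', fun a b c a' b' c' => ?_⟩
  simp only [_root_.localAct, Pi.add_apply, Pi.smul_apply, inner_add_left, inner_add_right,
    inner_smul_left, inner_smul_right, h, Matrix.map_apply, starRingEnd_apply, star_star]
  ring

theorem localAct_swap (h : HasPosPartialTranspose (fun a b c => v b a c))
    (g : Matrix (Fin 2) (Fin 2) ℂ) :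
    HasPosPartialTranspose (fun a b c => _root_.localAct g v b a c) := by
  obtain ⟨κ, _, v', h⟩ := h
  refine ⟨κ, inferInstance, fun a b c => _root_.localAct g (fun b a c => v' a b c) b a c,
    fun a b c a' b' c' => ?_⟩
  simp only [_root_.localAct, Pi.add_apply, Pi.smul_apply, inner_add_left, inner_add_right,
    inner_smul_left, inner_smul_right, h]

/-- The same combination of the `v' 1 b c` has the same norm, hence vanishes; pairing it with `v' 0
b c` gives the claim. -/
theorem inner_eq_zero (h : HasPosPartialTranspose v) (y : Fin 2 → Fin 2 → ℂ)
    (hy : ∑ b, ∑ c, y b c • v 1 b c = 0) (b c : Fin 2) :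
    inner ℂ (v 1 b c) (∑ b', ∑ c', y b' c' • v 0 b' c') = 0 := by
  obtain ⟨κ, _, v', h⟩ := h
  have h0 : ∑ b, ∑ c, y b c • v' 1 b c = 0 := by
    rw [← inner_self_eq_zero (𝕜 := ℂ)]
    have h1 := congrArg (fun w => inner ℂ w w) hy
    simp only [Fin.sum_univ_two, inner_add_left, inner_add_right, inner_smul_left,
      inner_smul_right, h, inner_zero_left] at h1 ⊢
    exact h1
  have h1 := congrArg (fun w => inner ℂ (v' 0 b c) w) h0
  simp only [Fin.sum_univ_two, inner_add_right, inner_smul_right, h, inner_zero_right] at h1 ⊢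
  exact h1

theorem slice (h : HasPosPartialTranspose v) (t : ℂ) :
    IsPPTFamily₂ (fun a c => v a 0 c - t • v a 1 c) := by
  obtain ⟨κ, _, v', h⟩ := h
  refine ⟨κ, inferInstance, fun a c => v' a 0 c - t • v' a 1 c, fun a c a' c' => ?_⟩
  simp only [inner_sub_left, inner_sub_right, inner_smul_left, inner_smul_right, h]

end HasPosPartialTranspose

namespace IsPPTFamily₃

variable {v : Fin 2 → Fin 2 → Fin 2 → E}

theorem swap₁₂ (h : IsPPTFamily₃ v) : IsPPTFamily₃ (fun a b c => v b a c) :=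
  ⟨h.2.1, h.1, h.2.2.swap₂₃⟩

theorem swap₁₃ (h : IsPPTFamily₃ v) : IsPPTFamily₃ (fun a b c => v c b a) :=
  ⟨h.2.2, h.2.1.swap₂₃, h.1⟩

theorem localAct (h : IsPPTFamily₃ v) (g : Matrix (Fin 2) (Fin 2) ℂ) :
    IsPPTFamily₃ (localAct g v) :=
  ⟨h.1.localAct g, h.2.1.localAct_swap g,
    (HasPosPartialTranspose.localAct_swap (v := fun a b c => v a c b) h.2.2.swap₂₃ g).swap₂₃⟩

end IsPPTFamily₃

namespace IsSepFamily₃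

variable {v : Fin 2 → Fin 2 → Fin 2 → E}

theorem swap₁₂ (h : IsSepFamily₃ v) : IsSepFamily₃ (fun a b c => v b a c) := by
  obtain ⟨ι, _, x, y, z, h⟩ := h
  refine ⟨ι, inferInstance, y, x, z, fun a b c a' b' c' => ?_⟩
  rw [h]
  refine Finset.sum_congr rfl fun i _ => ?_
  simp only [star_mul']
  ring

theorem swap₁₃ (h : IsSepFamily₃ v) : IsSepFamily₃ (fun a b c => v c b a) := by
  obtain ⟨ι, _, x, y, z, h⟩ := h
  refine ⟨ι, inferInstance, z, y, x, fun a b c a' b' c' => ?_⟩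
  rw [h]
  refine Finset.sum_congr rfl fun i _ => ?_
  simp only [star_mul']
  ring

theorem localAct (h : IsSepFamily₃ v) (g : Matrix (Fin 2) (Fin 2) ℂ) :
    IsSepFamily₃ (localAct g v) := by
  obtain ⟨ι, _, x, y, z, h⟩ := h
  refine ⟨ι, inferInstance, fun i => _root_.localAct g (x i), y, z, fun a b c a' b' c' => ?_⟩
  simp only [_root_.localAct, Pi.add_apply, Pi.smul_apply, inner_add_left, inner_add_right,
    inner_smul_left, inner_smul_right, h, Finset.mul_sum, ← Finset.sum_add_distrib,
    starRingEnd_apply]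
  refine Finset.sum_congr rfl fun i _ => ?_
  simp only [smul_eq_mul, star_mul', star_add]
  ring

theorem of_localAct {g : Matrix (Fin 2) (Fin 2) ℂ} (hg : g.det ≠ 0)
    (h : IsSepFamily₃ (_root_.localAct g v)) : IsSepFamily₃ v := by
  simpa only [localAct_inv hg] using h.localAct g⁻¹

theorem of_orthogonal {n : ℕ} (e : Fin n → E)
    (he : Pairwise fun i j => inner ℂ (e i) (e j) = 0) (x y z : Fin n → Fin 2 → ℂ)
    (hv : ∀ a b c, v a b c = ∑ i, (x i a * y i b * z i c) • e i) : IsSepFamily₃ v := by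
  refine ⟨Fin n, inferInstance, fun i a => ‖e i‖ * x i a, y, z, fun a b c a' b' c' => ?_⟩
  rw [hv, hv, sum_inner]
  refine Finset.sum_congr rfl fun i _ => ?_
  rw [inner_sum, Finset.sum_eq_single i]
  · rw [inner_smul_left, inner_smul_right, inner_self_eq_norm_sq_to_K]
    simp
    ring
  · intro j _ hj
    rw [inner_smul_left, inner_smul_right, he hj.symm]
    simp
  · simp

/-- A separable slice together with a product vector orthogonal to it. -/
theorem of_slice {u : Fin 2 → Fin 2 → E} (hu : IsSepFamily₂ u) (e : E)
    (he : ∀ a c, inner ℂ e (u a c) = 0) (x y z : Fin 2 → ℂ)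
    (hv : ∀ a b c, v a b c = (if b = 0 then u a c else 0) + (x a * y b * z c) • e) :
    IsSepFamily₃ v := by
  obtain ⟨ι, _, p, q, hpq⟩ := hu
  refine ⟨Option ι, inferInstance, fun i => i.elim (fun a => ‖e‖ * x a) p,
    fun i => i.elim y fun _ b => if b = 0 then 1 else 0, fun i => i.elim z q,
    fun a b c a' b' c' => ?_⟩
  have he' : ∀ a c, inner ℂ (u a c) e = 0 := fun a c => inner_eq_zero_symm.mp (he a c)
  rw [hv, hv, Fintype.sum_option]
  simp only [Option.elim_none, Option.elim_some]
  by_cases hb : b = 0 <;> by_cases hb' : b' = 0 <;>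
    simp [hb, hb', he, he', hpq] <;> ring

end IsSepFamily₃

end ThreeQubit

/-! ### Three-qubit PPT families of rank at most three. -/

section ThreeQubit

variable {E : Type*} [NormedAddCommGroup E] [InnerProductSpace ℂ E]
  {v : Fin 2 → Fin 2 → Fin 2 → E}

theorem HasPosPartialTranspose.inner_eq_zero_of_apply_eq_zero (h : HasPosPartialTranspose v)
    {b c : Fin 2} (h0 : v 1 b c = 0) (b' c' : Fin 2) : inner ℂ (v 1 b' c') (v 0 b c) = 0 := by
  have h1 := h.inner_eq_zero (fun b' c' => if b' = b ∧ c' = c then 1 else 0)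
    (by simp [ite_and, h0]) b' c'
  simpa [ite_and] using h1

theorem exists_trilinear_zero_of_finrank_le [FiniteDimensional ℂ E]
    (hE : Module.finrank ℂ E ≤ 3) (v : Fin 2 → Fin 2 → Fin 2 → E) :
    ∃ x y z : Fin 2 → ℂ, x ≠ 0 ∧ y ≠ 0 ∧ z ≠ 0 ∧
      ∑ a, ∑ b, (x a * y b) • (z 0 • v a b 0 + z 1 • v a b 1) = 0 := by
  let β := Module.finBasis ℂ E
  let f (w : E) (k : Fin 3) : ℂ :=
    -- Coordinates are padded with zeros when the dimension is below three.
    if hk : (k : ℕ) < Module.finrank ℂ E then β.repr w ⟨k, hk⟩ else 0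
  obtain ⟨x, y, z, hx, hy, hz, h⟩ :=
    exists_trilinear_zero (fun a b k => f (v a b 0) k) (fun a b k => f (v a b 1) k)
  refine ⟨x, y, z, hx, hy, hz, ?_⟩
  apply β.ext_elem
  intro i
  have := h ⟨i, by omega⟩
  simpa [f, mul_add] using this

/-- The three neighbours of `v 1 1 1` form an orthogonal basis. Each of the vectors with a single
index 1 lies in the span of two of them, and PPT then fixes the coordinates of `v 0 0 0` to be
exactly those of three product terms. -/
theorem isSepFamily₃_of_ne_zero [FiniteDimensional ℂ E] (hE : Module.finrank ℂ E ≤ 3)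
    (h : IsPPTFamily₃ v) (h111 : v 1 1 1 = 0) (h1 : v 0 1 1 ≠ 0) (h2 : v 1 0 1 ≠ 0)
    (h3 : v 1 1 0 ≠ 0) : IsSepFamily₃ v := by
  have hA := h.1.inner_eq_zero_of_apply_eq_zero h111
  have hB := h.2.1.inner_eq_zero_of_apply_eq_zero h111
  have hC := h.2.2.inner_eq_zero_of_apply_eq_zero h111
  have h21 : inner ℂ (v 1 0 1) (v 0 1 1) = 0 := hA 0 1
  have h31 : inner ℂ (v 1 1 0) (v 0 1 1) = 0 := hA 1 0
  have h32 : inner ℂ (v 1 1 0) (v 1 0 1) = 0 := hB 1 0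
  have h12 := inner_eq_zero_symm.mp h21
  have h13 := inner_eq_zero_symm.mp h31
  have h23 := inner_eq_zero_symm.mp h32
  obtain ⟨s, s', hs⟩ := exists_smul_of_inner_eq_zero hE h1 h2 h3 h12 h13 h23
    (inner_eq_zero_symm.mp (hA 0 0))
  obtain ⟨t, t', ht⟩ := exists_smul_of_inner_eq_zero hE h2 h1 h3 h21 h23 h13
    (inner_eq_zero_symm.mp (hB 0 0))
  obtain ⟨r, r', hr⟩ := exists_smul_of_inner_eq_zero hE h3 h1 h2 h31 h32 h12
    (inner_eq_zero_symm.mp (hC 0 0))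
  have hA' := h.1.inner_eq_zero ![![1, -s], ![-s', 0]] (by simp [hs])
  have hB' := h.2.1.inner_eq_zero ![![1, -t], ![-t', 0]] (by simp [ht])
  have hA2 := hA' 0 1
  have hA3 := hA' 1 0
  have hB1 := hB' 0 1
  simp [-inner_self_eq_norm_sq_to_K, hs, ht, hr, h12, h13, h23, h21, h31, h32] at hA2 hA3 hB1
  have h000 : v 0 0 0 - ((t * r) • v 0 1 1 + (s * r') • v 1 0 1 + (s' * t') • v 1 1 0) = 0 := by
    refine eq_zero_of_inner_eq_zero hE h1 h2 h3 h12 h13 h23 ?_ ?_ ?_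
    · simp [-inner_self_eq_norm_sq_to_K, h12, h13]
      linear_combination hB1
    · simp [-inner_self_eq_norm_sq_to_K, h21, h23]
      linear_combination hA2
    · simp [-inner_self_eq_norm_sq_to_K, h31, h32]
      linear_combination hA3
  rw [sub_eq_zero] at h000
  refine IsSepFamily₃.of_orthogonal ![v 0 1 1, v 1 0 1, v 1 1 0] ?_
    ![![1, 0], ![r', 1], ![t', 1]] ![![r, 1], ![1, 0], ![s', 1]] ![![t, 1], ![s, 1], ![1, 0]] ?_
  · intro i j hij
    fin_cases i <;> fin_cases j <;> first
      | exact absurd rfl hij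
      | assumption
  · simp only [Fin.forall_fin_two, Fin.sum_univ_three]
    simp [h111, h000, hs, ht, hr, mul_comm]

/-- `v 0 1 0` is the only possibly nonzero vector with middle index 1, and it is orthogonal to all
the others except perhaps `v 0 0 0`. Removing its component there leaves a two-qubit family
orthogonal to it. -/
theorem isSepFamily₃_of_three_eq_zero [FiniteDimensional ℂ E] (hE : Module.finrank ℂ E ≤ 3)
    (h : IsPPTFamily₃ v) (h111 : v 1 1 1 = 0) (h110 : v 1 1 0 = 0) (h011 : v 0 1 1 = 0) :
    IsSepFamily₃ v := by
  have hA := h.1.inner_eq_zero_of_apply_eq_zero h110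
  have hC := h.2.2.inner_eq_zero_of_apply_eq_zero (b := 1) (c := 0) h011
  obtain ⟨t, ht⟩ := exists_inner_sub_smul_eq_zero (v 0 1 0) (v 0 0 0)
  refine IsSepFamily₃.of_slice (isSepFamily₂_of_finrank_le hE (h.1.slice t)) (v 0 1 0) ?_
    ![1, 0] ![t, 1] ![1, 0] ?_
  · simp only [Fin.forall_fin_two, h111, h110, h011, smul_zero, sub_zero]
    exact ⟨⟨ht, inner_eq_zero_symm.mp (hC 0 0)⟩, inner_eq_zero_symm.mp (hA 0 0),
      inner_eq_zero_symm.mp (hA 0 1)⟩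
  · simp only [Fin.forall_fin_two]
    simp [h111, h110, h011]

theorem isSepFamily₃_of_dependent [FiniteDimensional ℂ E] (hE : Module.finrank ℂ E ≤ 3)
    (h : IsPPTFamily₃ v) (h111 : v 1 1 1 = 0) (h110 : v 1 1 0 = 0) {z : Fin 2 → ℂ} (hz : z ≠ 0)
    (hzv : z 0 • v 0 1 0 + z 1 • v 0 1 1 = 0) : IsSepFamily₃ v := by
  obtain ⟨g, hg, rfl⟩ := exists_det_ne_zero_row_one hz
  refine IsSepFamily₃.swap₁₃ (v := fun a b c => v c b a) (IsSepFamily₃.of_localAct hg ?_)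
  refine IsSepFamily₃.swap₁₃ (v := fun a b c => localAct g (fun a b c => v c b a) c b a) ?_
  refine isSepFamily₃_of_three_eq_zero hE (h.swap₁₃.localAct g).swap₁₃ ?_ ?_ ?_
  · simp [localAct, h111, h110]
  · simp [localAct, h111, h110]
  · simpa [localAct] using hzv

/-- The pairs `v 0 1` and `v 1 0` span orthogonal subspaces. In dimension at most three the four
vectors are dependent, and by orthogonality the relation splits, so one of the pairs is itself
dependent. -/
theorem isSepFamily₃_of_two_eq_zero [FiniteDimensional ℂ E] (hE : Module.finrank ℂ E ≤ 3)
    (h : IsPPTFamily₃ v) (h111 : v 1 1 1 = 0) (h110 : v 1 1 0 = 0) : IsSepFamily₃ v := by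
  have horth : ∀ c c', inner ℂ (v 1 0 c') (v 0 1 c) = 0 := by
    simp only [Fin.forall_fin_two]
    have h0 := h.1.inner_eq_zero_of_apply_eq_zero h110
    have h1 := h.1.inner_eq_zero_of_apply_eq_zero h111
    exact ⟨⟨h0 0 0, h0 0 1⟩, h1 0 0, h1 0 1⟩
  obtain ⟨m, hm, hsum⟩ := exists_sum_smul_eq_zero hE ![v 0 1, v 1 0]
  simp only [Fin.sum_univ_two, Matrix.cons_val_zero, Matrix.cons_val_one] at hsum
  have h1 : m 1 0 • v 1 0 0 + m 1 1 • v 1 0 1 = 0 := by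
    rw [← inner_self_eq_zero (𝕜 := ℂ)]
    have := congrArg (fun w => inner ℂ (m 1 0 • v 1 0 0 + m 1 1 • v 1 0 1) w) hsum
    simpa only [inner_add_right, inner_add_left, inner_smul_left, inner_smul_right, horth,
      inner_zero_right, mul_zero, zero_add, add_zero] using this
  rw [h1, add_zero] at hsum
  by_cases h0 : m 0 = 0
  · have hm1 : m 1 ≠ 0 := by
      intro h2
      apply hm
      funext a
      revert a
      simp [Fin.forall_fin_two, h0, h2]
    exact (isSepFamily₃_of_dependent hE h.swap₁₂ h111 h110 hm1 h1).swap₁₂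
  · exact isSepFamily₃_of_dependent hE h h111 h110 h0 hsum

theorem isSepFamily₃_of_apply_eq_zero [FiniteDimensional ℂ E] (hE : Module.finrank ℂ E ≤ 3)
    (h : IsPPTFamily₃ v) (h111 : v 1 1 1 = 0) : IsSepFamily₃ v := by
  by_cases h3 : v 1 1 0 = 0
  · exact isSepFamily₃_of_two_eq_zero hE h h111 h3
  by_cases h1 : v 0 1 1 = 0
  · exact (isSepFamily₃_of_two_eq_zero hE h.swap₁₃ h111 h1).swap₁₃
  by_cases h2 : v 1 0 1 = 0
  · exact (isSepFamily₃_of_two_eq_zero hE h.swap₁₂.swap₁₃ h111 h2).swap₁₃.swap₁₂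
  exact isSepFamily₃_of_ne_zero hE h h111 h1 h2 h3

theorem isSepFamily₃_of_finrank_le [FiniteDimensional ℂ E] (hE : Module.finrank ℂ E ≤ 3)
    (h : IsPPTFamily₃ v) : IsSepFamily₃ v := by
  obtain ⟨x, y, z, hx, hy, hz, hsum⟩ := exists_trilinear_zero_of_finrank_le hE v
  obtain ⟨g₁, hg₁, rfl⟩ := exists_det_ne_zero_row_one hx
  obtain ⟨g₂, hg₂, rfl⟩ := exists_det_ne_zero_row_one hy
  obtain ⟨g₃, hg₃, rfl⟩ := exists_det_ne_zero_row_one hz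
  refine IsSepFamily₃.of_localAct hg₁ (IsSepFamily₃.swap₁₂ (IsSepFamily₃.of_localAct hg₂
    (IsSepFamily₃.swap₁₃ (IsSepFamily₃.of_localAct hg₃ ?_))))
  refine isSepFamily₃_of_apply_eq_zero hE
    (((h.localAct g₁).swap₁₂.localAct g₂).swap₁₃.localAct g₃) ?_
  rw [← hsum]
  simp only [localAct, Pi.add_apply, Pi.smul_apply, Fin.sum_univ_two]
  module

end ThreeQubit

/-! ### From density matrices to Gram families and back. -/

theorem Matrix.PosSemidef.exists_gram_eq {m : Type*} [Fintype m] [DecidableEq m]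
    {A : Matrix m m ℂ} (hA : A.PosSemidef) :
    ∃ (S : Submodule ℂ (EuclideanSpace ℂ m)) (w : m → S), Module.finrank ℂ S = A.rank ∧
      ∀ i j, A i j = inner ℂ (w i) (w j) := by
  obtain ⟨B, rfl⟩ := hA.exists_eq_conjTranspose_mul_self
  let e : EuclideanSpace ℂ m ≃ₗ[ℂ] (m → ℂ) := WithLp.linearEquiv 2 ℂ (m → ℂ)
  refine ⟨(Submodule.span ℂ (Set.range B.col)).map e.symm.toLinearMap,
    fun i => ⟨e.symm (B.col i),
      Submodule.mem_map_of_mem (Submodule.subset_span (Set.mem_range_self i))⟩, ?_, ?_⟩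
  · rw [LinearEquiv.finrank_map_eq, Matrix.rank_conjTranspose_mul_self,
      Matrix.rank_eq_finrank_span_cols]
  · intro i j
    rw [Submodule.coe_inner, PiLp.inner_apply, Matrix.mul_apply]
    refine Finset.sum_congr rfl fun k _ => ?_
    simp [e, mul_comm]

theorem qubitIdx_three_eq (a : QubitIdx 3) : a = ![a 0, a 1, a 2] := by
  funext i
  fin_cases i <;> rfl

theorem isPPTFamily₃_of_isPPT {E : Type*} [NormedAddCommGroup E] [InnerProductSpace ℂ E]
    {ρ : QubitMat 3} (h : IsPPT ρ) (w : QubitIdx 3 → E) (hw : ∀ i j, ρ i j = inner ℂ (w i) (w j)) :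
    IsPPTFamily₃ (fun a b c => w ![a, b, c]) := by
  have key : ∀ s : Fin 3, ∃ w' : QubitIdx 3 → EuclideanSpace ℂ (QubitIdx 3), ∀ i j,
      inner ℂ (w' i) (w' j) = inner ℂ (w fun k => if k = s then j k else i k)
        (w fun k => if k = s then i k else j k) := by
    intro s
    obtain ⟨S, w', -, hw'⟩ := (h {s}).exists_gram_eq
    refine ⟨fun i => w' i, fun i j => ?_⟩
    rw [← Submodule.coe_inner, ← hw', ← hw]
    simp [partialTranspose]
  refine ⟨?_, ?_, ?_⟩
  · obtain ⟨w', hw'⟩ := key 0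
    refine ⟨_, inferInstance, fun a b c => w' ![a, b, c], fun a b c a' b' c' => ?_⟩
    rw [hw']
    congr 2 <;> funext k <;> fin_cases k <;> simp
  · obtain ⟨w', hw'⟩ := key 1
    refine ⟨_, inferInstance, fun a b c => w' ![b, a, c], fun a b c a' b' c' => ?_⟩
    rw [hw']
    congr 2 <;> funext k <;> fin_cases k <;> simp
  · obtain ⟨w', hw'⟩ := key 2
    refine ⟨_, inferInstance, fun a b c => w' ![c, b, a], fun a b c a' b' c' => ?_⟩
    rw [hw']
    congr 2 <;> funext k <;> fin_cases k <;> simp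

theorem trace_vecMulVec_productVector {n : ℕ} (x : Fin n → EuclideanSpace ℂ (Fin 2)) :
    (Matrix.vecMulVec (productVector x) (star (productVector x))).trace =
      ((∏ i, ‖x i‖ ^ 2 : ℝ) : ℂ) := by
  have h : ∀ i, ((‖x i‖ ^ 2 : ℝ) : ℂ) = ∑ c, x i c * star (x i c) := by
    intro i
    rw [EuclideanSpace.norm_sq_eq, Complex.ofReal_sum]
    refine Finset.sum_congr rfl fun c _ => ?_
    rw [Complex.star_def, Complex.mul_conj, Complex.normSq_eq_norm_sq]
  rw [Complex.ofReal_prod, Finset.prod_congr rfl fun i _ => h i, Finset.prod_univ_sum,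
    Fintype.piFinset_univ]
  simp [Matrix.trace, Matrix.vecMulVec_apply, productVector, Finset.prod_mul_distrib]

theorem vecMulVec_productVector_smul {n : ℕ} (c : Fin n → ℝ)
    (x : Fin n → EuclideanSpace ℂ (Fin 2)) :
    Matrix.vecMulVec (productVector fun i => c i • x i) (star (productVector fun i => c i • x i)) =
      (∏ i, c i ^ 2) • Matrix.vecMulVec (productVector x) (star (productVector x)) := by
  ext a b
  simp [Matrix.vecMulVec_apply, productVector, Finset.prod_mul_distrib, Finset.prod_pow]
  ring

theorem exists_smul_pureProductStates {n : ℕ} (x : Fin n → EuclideanSpace ℂ (Fin 2)) :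
    ∃ σ ∈ pureProductStates n,
      Matrix.vecMulVec (productVector x) (star (productVector x)) = (∏ i, ‖x i‖ ^ 2) • σ := by
  have hu : ∀ y : EuclideanSpace ℂ (Fin 2), ∃ u : EuclideanSpace ℂ (Fin 2),
      ‖u‖ = 1 ∧ y = ‖y‖ • u := by
    intro y
    by_cases hy : y = 0
    · exact ⟨EuclideanSpace.single 0 1, by simp, by simp [hy]⟩
    · have hy' : ‖y‖ ≠ 0 := norm_ne_zero_iff.mpr hy
      exact ⟨‖y‖⁻¹ • y, by rw [norm_smul, norm_inv, norm_norm, inv_mul_cancel₀ hy'],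
        by rw [smul_smul, mul_inv_cancel₀ hy', one_smul]⟩
  choose u hu1 hu2 using hu
  refine ⟨_, ⟨fun i => u (x i), fun i => hu1 _, rfl⟩, ?_⟩
  rw [← vecMulVec_productVector_smul]
  simp only [← hu2]

/-- Normalising the factors leaves nonnegative weights, which sum to one by the trace condition. -/
theorem isSeparableState_of_eq_sum {n : ℕ} {ρ : QubitMat n} (htr : ρ.trace = 1) {ι : Type*}
    [Fintype ι] (x : ι → Fin n → EuclideanSpace ℂ (Fin 2))
    (h : ρ = ∑ i, Matrix.vecMulVec (productVector (x i)) (star (productVector (x i)))) :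
    IsSeparableState ρ := by
  choose σ hσ hx using fun i => exists_smul_pureProductStates (x i)
  have hsum : ∑ i, ∏ k, ‖x i k‖ ^ 2 = 1 := by
    rw [h, Matrix.trace_sum] at htr
    simp only [trace_vecMulVec_productVector] at htr
    exact_mod_cast htr
  rw [h]
  simp only [hx]
  exact (convex_convexHull ℝ _).sum_mem (fun i _ => by positivity) hsum
    fun i _ => subset_convexHull ℝ _ (hσ i)

theorem isSeparableState_of_isPPT_of_rank_le {ρ : QubitMat 3} (hρ : IsQubitState ρ) (h : IsPPT ρ)
    (hr : ρ.rank ≤ 3) : IsSeparableState ρ := by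
  obtain ⟨S, w, hS, hw⟩ := hρ.1.exists_gram_eq
  obtain ⟨ι, _, x, y, z, hsum⟩ :=
    isSepFamily₃_of_finrank_le (hS.trans_le hr) (isPPTFamily₃_of_isPPT h w hw)
  refine isSeparableState_of_eq_sum hρ.2
    (fun i => ![WithLp.toLp 2 (star (x i)), WithLp.toLp 2 (star (y i)),
      WithLp.toLp 2 (star (z i))]) ?_
  ext a b
  rw [hw, qubitIdx_three_eq a, qubitIdx_three_eq b, hsum, Matrix.sum_apply]
  refine Finset.sum_congr rfl fun i _ => ?_
  simp [Matrix.vecMulVec_apply, productVector, Fin.prod_univ_three]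

theorem mainTheorem7 :
    (∀ (n : ℕ), 1 ≤ n → ∀ ρ : QubitMat n, IsQubitState ρ → lorentzInvariant ρ = 0 →
      ρ.rank ≤ 2 ^ (n - 1)) ∧
    (∀ ρ : QubitMat 3, IsPPTEntangledState ρ → lorentzInvariant ρ = 0 → ρ.rank = 4) := by
  refine ⟨fun n hn ρ hρ h => rank_le_of_lorentzInvariant_eq_zero hn hρ.1 h,
    fun ρ ⟨hρ, hppt, hsep⟩ h => ?_⟩
  have h4 : ρ.rank ≤ 4 := rank_le_of_lorentzInvariant_eq_zero (by norm_num) hρ.1 h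
  by_contra hne
  exact hsep (isSeparableState_of_isPPT_of_rank_le hρ hppt (by omega))
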